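/- Let $\mathcal Y$ be a complete, separable, locally compact metric space with Borel $\sigma$-algebra $\mathcal G$, and let $\mu$ be a $\sigma$-finite Radon measure on $(\mathcal Y,\mathcal G)$. Let $\mathcal P$ be the set of all probability measures on $(\mathcal Y,\mathcal G)$ dominated by $\mu$, equipped with the Borel $\sigma$-algebra of the weak topology, let $\pi$ be a probability measure on $\mathcal P$, and let $n\ge 0$ be an integer. Let $P_\pi^X$ be the prior predictive law of $X=(Y_1,\dots,Y_n)$, i.e. the probability measure on $\mathcal Y^n$ with $P_\pi^X(G_1\times\cdots\times G_n)=\int\prod_{i=1}^n P(G_i)\,\pi(dP)$, and let $P_\pi^{X,Y_{n+1}}=\int P^{n+1}\,\pi(dP)$ be the prior predictive law of $(Y_1,\dots,Y_{n+1})$. Let $R=P_\pi^X\times\mu$ on $\mathcal Y^{n+1}=\mathcal Y^n\times\mathcal Y$; $R(A)$ is the Bayes risk of the region $A$, that is, the expectation under $P_\pi^X$ of the $\mu$-volume of the section $A_X=\{y:(X,y)\in A\}$. Let $Z(y_1,\dots,y_{n+1})=\frac1{n+1}\sum_{i=1}^{n+1}\delta_{y_i}$ be the empirical distribution, with values in the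 space of Borel probability measures on $\mathcal Y$ with the Borel $\sigma$-algebra of the weak topology. Then: 1. $R$ is a $\sigma$-finite Radon measure. 2. $Z$ is measurable and the image measure $\nu_R=R\circ Z^{-1}$ is $\sigma$-finite. 3. $R$ has a $(Z,\nu_R)$-disintegration: there are $\sigma$-finite measures $R_z$ on $\mathcal Y^{n+1}$ such that, for every measurable $A$, $z\mapsto R_z(A)$ is measurable and $R(A)=\int R_z(A)\,\nu_R(dz)$, and $R_z$ is concentrated on $Z^{-1}\{z\}$ for $\nu_R$-almost all $z$. Suppose in addition that - (A1) $\mu$ is non-atomic, or $\mathcal Y$ is discrete and $\mu$ is counting measure, and - (A2) $P_\pi^X$ and $\mu^n$ are mutually absolutely continuous. Then, for the model $\{P^{n+1}:P\in\mathcal P\}$ on $\mathcal Y^{n+1}$: 4. $Z$ is a regular sufficient statistic: there is a Markov kernel $(z,A)\mapsto P_z(A)$ such that $P_Z(A)$ is a version of $P^{n+1}(A\mid Z)$ for all $P\in\mathcal P$ and all measurable $A$, and such that, for every $P\in\mathcal P$, $P_z(Z^{-1}\{z\})=1$ for almost all $z$ under the law of $Z$ under $P^{n+1}$. 5. $Z$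 is complete: if $f$ is a measurable real function with $f(Z)$ integrable under $P^{n+1}$ for every $P\in\mathcal P$ and $\int f(Z)\,dP^{n+1}=c$ for all $P\in\mathcal P$, then $f(Z)=c$ $P^{n+1}$-almost surely for all $P\in\mathcal P$. 6. Let $p_\pi(y_1,\dots,y_n)$ and $p_\pi(y_1,\dots,y_{n+1})$ be any nonnegative, real-valued versions of the densities of $P_\pi^X$ with respect to $\mu^n$ and of $P_\pi^{X,Y_{n+1}}$ with respect to $\mu^{n+1}$, let $p_\pi(y_{n+1}\mid y_1,\dots,y_n)=p_\pi(y_1,\dots,y_{n+1})/p_\pi(y_1,\dots,y_n)$ be the posterior predictive density, and let $z\mapsto k_z$ be any real-valued function for which the region $$A^\pi=\{(y_1,\dots,y_{n+1}): p_\pi(y_{n+1}\mid y_1,\dots,y_n)>k_{Z(y_1,\dots,y_{n+1})}\}$$ is measurable. If $A\subseteq\mathcal Y^{n+1}$ is measurable and $P^{n+1}(A)=P^{n+1}(A^\pi)$ for all $P\in\mathcal P$, then $R(A)\ge R(A^\pi)$, with equality only if $R(A^\pi)=\infty$ or $P^{n+1}(A\,\Delta\,A^\pi)=0$ for all $P\in\mathcal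 P$. -/

import Mathlib

open MeasureTheory ProbabilityTheory Filter Topology
open scoped ENNReal NNReal

noncomputable section

/-! ### Spaces of laws, with the weak topology and its Borel σ-algebra -/

/-- Borel probability measures on `𝒴`, with the topology of weak convergence and the Borel
σ-algebra of that topology. -/
def WeakLaw (𝒴 : Type*) [MeasurableSpace 𝒴] : Type _ := ProbabilityMeasure 𝒴

instance WeakLaw.instTopologicalSpace (𝒴 : Type*) [TopologicalSpace 𝒴] [MeasurableSpace 𝒴]
    [OpensMeasurableSpace 𝒴] : TopologicalSpace (WeakLaw 𝒴) :=
  inferInstanceAs (TopologicalSpace (ProbabilityMeasure 𝒴))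

instance WeakLaw.instMeasurableSpace (𝒴 : Type*) [TopologicalSpace 𝒴] [MeasurableSpace 𝒴]
    [OpensMeasurableSpace 𝒴] : MeasurableSpace (WeakLaw 𝒴) := borel (WeakLaw 𝒴)

/-- The nonparametric model: the probability measures on `𝒴` that are dominated by `μ`, with the
weak topology and its Borel σ-algebra. -/
def DominatedLaw {𝒴 : Type*} [MeasurableSpace 𝒴] (μ : Measure 𝒴) : Type _ :=
  {P : ProbabilityMeasure 𝒴 // (P : Measure 𝒴) ≪ μ}

/-- The probability measure underlying a member of the model. -/
def DominatedLaw.toMeasure {𝒴 : Type*} [MeasurableSpace 𝒴] {μ : Measure 𝒴}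
    (P : DominatedLaw μ) : Measure 𝒴 := (P.1 : Measure 𝒴)

instance DominatedLaw.instIsProbabilityMeasure {𝒴 : Type*} [MeasurableSpace 𝒴] {μ : Measure 𝒴}
    (P : DominatedLaw μ) : IsProbabilityMeasure P.toMeasure :=
  inferInstanceAs (IsProbabilityMeasure (P.1 : Measure 𝒴))

instance DominatedLaw.instTopologicalSpace {𝒴 : Type*} [TopologicalSpace 𝒴] [MeasurableSpace 𝒴]
    [OpensMeasurableSpace 𝒴] (μ : Measure 𝒴) : TopologicalSpace (DominatedLaw μ) :=
  inferInstanceAs (TopologicalSpace {P : ProbabilityMeasure 𝒴 // (P : Measure 𝒴) ≪ μ})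

instance DominatedLaw.instMeasurableSpace {𝒴 : Type*} [TopologicalSpace 𝒴] [MeasurableSpace 𝒴]
    [OpensMeasurableSpace 𝒴] (μ : Measure 𝒴) : MeasurableSpace (DominatedLaw μ) :=
  borel (DominatedLaw μ)

instance WeakLaw.instBorelSpace (𝒴 : Type*) [TopologicalSpace 𝒴] [MeasurableSpace 𝒴]
    [OpensMeasurableSpace 𝒴] : BorelSpace (WeakLaw 𝒴) := ⟨rfl⟩

instance DominatedLaw.instBorelSpace {𝒴 : Type*} [TopologicalSpace 𝒴] [MeasurableSpace 𝒴]
    [OpensMeasurableSpace 𝒴] (μ : Measure 𝒴) : BorelSpace (DominatedLaw μ) := ⟨rfl⟩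

/-! ### Sampling distributions, prior predictive distributions and the risk measure -/

/-- `P^n`, the joint law of `X = (Y₁, …, Yₙ)` for an i.i.d. sample from `P`. -/
def xLaw {𝒴 : Type*} [MeasurableSpace 𝒴] {μ : Measure 𝒴} (n : ℕ) (P : DominatedLaw μ) :
    Measure (Fin n → 𝒴) := Measure.pi (fun _ : Fin n => P.toMeasure)

/-- `P^{n+1}`, the joint law of `(X, Yₙ₊₁)`. -/
def sampleLaw {𝒴 : Type*} [MeasurableSpace 𝒴] {μ : Measure 𝒴} (n : ℕ) (P : DominatedLaw μ) :
    Measure ((Fin n → 𝒴) × 𝒴) := (xLaw n P).prod P.toMeasure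

instance xLaw.instIsProbabilityMeasure {𝒴 : Type*} [MeasurableSpace 𝒴] {μ : Measure 𝒴} (n : ℕ)
    (P : DominatedLaw μ) : IsProbabilityMeasure (xLaw n P) := by
  unfold xLaw; infer_instance

instance sampleLaw.instIsProbabilityMeasure {𝒴 : Type*} [MeasurableSpace 𝒴] {μ : Measure 𝒴}
    (n : ℕ) (P : DominatedLaw μ) : IsProbabilityMeasure (sampleLaw n P) := by
  unfold sampleLaw; infer_instance

/-- The prior predictive law of `X = (Y₁, …, Yₙ)`: the `π`-mixture of the laws `P^n`. -/
def xPredictive {𝒴 : Type*} [TopologicalSpace 𝒴] [MeasurableSpace 𝒴] [OpensMeasurableSpace 𝒴]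
    {μ : Measure 𝒴} (n : ℕ) (π : Measure (DominatedLaw μ)) : Measure (Fin n → 𝒴) :=
  π.bind (xLaw n)

/-- The prior predictive law of `(X, Yₙ₊₁)`: the `π`-mixture of the laws `P^{n+1}`. -/
def samplePredictive {𝒴 : Type*} [TopologicalSpace 𝒴] [MeasurableSpace 𝒴]
    [OpensMeasurableSpace 𝒴] {μ : Measure 𝒴} (n : ℕ) (π : Measure (DominatedLaw μ)) :
    Measure ((Fin n → 𝒴) × 𝒴) :=
  π.bind (sampleLaw n)

/-- The Bayes risk `R(A) = ∫∫ 1((x, y) ∈ A) P_π^X(dx) μ(dy)`, the expected `μ`-volume of the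
section `A_x`: the product of the prior predictive law of `X` and `μ`. -/
def riskMeasure {𝒴 : Type*} [TopologicalSpace 𝒴] [MeasurableSpace 𝒴] [OpensMeasurableSpace 𝒴]
    {μ : Measure 𝒴} (n : ℕ) (π : Measure (DominatedLaw μ)) : Measure ((Fin n → 𝒴) × 𝒴) :=
  (xPredictive n π).prod μ

/-! The two mixtures are mixtures of measurable families, so they have the expected values. -/

theorem DominatedLaw.measurable_toMeasure {𝒴 : Type*} [TopologicalSpace 𝒴] [MeasurableSpace 𝒴]
    [BorelSpace 𝒴] [HasOuterApproxClosed 𝒴] (μ : Measure 𝒴) :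
    Measurable (DominatedLaw.toMeasure : DominatedLaw μ → Measure 𝒴) := by
  refine Measurable.measure_of_isPiSystem_of_isProbabilityMeasure
    (S := {s | IsClosed s}) ?_ isPiSystem_isClosed ?_
  · rw [BorelSpace.measurable_eq (α := 𝒴), borel_eq_generateFrom_isClosed]
  · intro F hF
    have hF' : IsClosed F := hF
    refine ENNReal.measurable_of_tendsto (f := fun m P => ∫⁻ y, hF'.apprSeq m y ∂P.toMeasure)
      (fun m => ?_) ?_
    · have h := (ENNReal.continuous_coe.comp
        (ProbabilityMeasure.continuous_testAgainstNN_eval (hF'.apprSeq m))).comp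
        (continuous_subtype_val (p := fun P : ProbabilityMeasure 𝒴 => (P : Measure 𝒴) ≪ μ))
      have h' := Continuous.measurable (α := DominatedLaw μ) h
      have e : (fun P : DominatedLaw μ => ∫⁻ y, hF'.apprSeq m y ∂P.toMeasure) =
          fun P : DominatedLaw μ =>
            ((P.1.toFiniteMeasure.testAgainstNN (hF'.apprSeq m) : ℝ≥0) : ℝ≥0∞) := by
        funext P
        exact (FiniteMeasure.testAgainstNN_coe_eq (μ := P.1.toFiniteMeasure)
          (f := hF'.apprSeq m)).symm
      rw [e]
      exact h'
    · rw [tendsto_pi_nhds]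
      intro P
      exact HasOuterApproxClosed.tendsto_lintegral_apprSeq hF' P.toMeasure

theorem measurable_xLaw {𝒴 : Type*} [TopologicalSpace 𝒴] [MeasurableSpace 𝒴]
    [BorelSpace 𝒴] [HasOuterApproxClosed 𝒴] (μ : Measure 𝒴) (n : ℕ) :
    Measurable (xLaw n : DominatedLaw μ → Measure (Fin n → 𝒴)) := by
  refine Measurable.measure_of_isPiSystem_of_isProbabilityMeasure
    generateFrom_pi.symm isPiSystem_pi ?_
  rintro _ ⟨G, hG, rfl⟩
  simp only [xLaw, Measure.pi_pi]
  exact Finset.measurable_prod _ fun i _ =>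
    (Measure.measurable_coe (hG i (Set.mem_univ i))).comp (DominatedLaw.measurable_toMeasure μ)

theorem measurable_sampleLaw {𝒴 : Type*} [TopologicalSpace 𝒴] [MeasurableSpace 𝒴]
    [BorelSpace 𝒴] [HasOuterApproxClosed 𝒴] (μ : Measure 𝒴) (n : ℕ) :
    Measurable (sampleLaw n : DominatedLaw μ → Measure ((Fin n → 𝒴) × 𝒴)) := by
  refine Measurable.measure_of_isPiSystem_of_isProbabilityMeasure
    generateFrom_prod.symm isPiSystem_prod ?_
  rintro _ ⟨F, hF, G, hG, rfl⟩
  have hF : MeasurableSet F := hF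
  have hG : MeasurableSet G := hG
  simp only [sampleLaw, Measure.prod_prod]
  exact ((Measure.measurable_coe hF).comp (measurable_xLaw μ n)).mul
    ((Measure.measurable_coe hG).comp (DominatedLaw.measurable_toMeasure μ))

/-- `P_π^X(G₁ × ⋯ × Gₙ) = ∫ ∏ᵢ P(Gᵢ) π(dP)`. -/
theorem xPredictive_pi {𝒴 : Type*} [TopologicalSpace 𝒴] [MeasurableSpace 𝒴]
    [BorelSpace 𝒴] [HasOuterApproxClosed 𝒴] {μ : Measure 𝒴} (n : ℕ)
    (π : Measure (DominatedLaw μ)) (G : Fin n → Set 𝒴) (hG : ∀ i, MeasurableSet (G i)) :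
    xPredictive n π (Set.univ.pi G) = ∫⁻ P, ∏ i, P.toMeasure (G i) ∂π := by
  rw [xPredictive, Measure.bind_apply (MeasurableSet.univ_pi hG) (measurable_xLaw μ n).aemeasurable]
  simp only [xLaw, Measure.pi_pi]

/-! ### The empirical distribution -/

/-- The empirical distribution `Z(y₁, …, yₙ₊₁)` of the `n + 1` observations
`y₁, …, yₙ` (the components of `ω.1`) and `yₙ₊₁ = ω.2`. -/
def empirical {𝒴 : Type*} [MeasurableSpace 𝒴] (n : ℕ) (ω : (Fin n → 𝒴) × 𝒴) : WeakLaw 𝒴 :=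
  (⟨((n + 1 : ℕ) : ℝ≥0∞)⁻¹ • (∑ i : Fin n, Measure.dirac (ω.1 i) + Measure.dirac ω.2), by
    constructor
    rw [Measure.smul_apply, Measure.add_apply, Measure.finsetSum_apply]
    simp only [measure_univ, Finset.sum_const, Finset.card_univ, Fintype.card_fin, smul_eq_mul,
      nsmul_eq_mul, mul_one]
    rw [← Nat.cast_add_one]
    exact ENNReal.inv_mul_cancel (by simp) (ENNReal.natCast_ne_top _)⟩ : ProbabilityMeasure 𝒴)

/-! ### Disintegration, sufficiency, completeness, densities -/

/-- `R` has a `(Z, ν)`-disintegration, `ν` being the image of `R` under `Z`: there are σ-finite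
measures `R_z`, depending measurably on `z`, with `R(A) = ∫ R_z(A) ν(dz)`, where `R_z` is
concentrated on the fiber `Z⁻¹{z}` for `ν`-almost all `z`. -/
def HasDisintegration {Ω 𝒵 : Type*} [MeasurableSpace Ω] [MeasurableSpace 𝒵]
    (R : Measure Ω) (Z : Ω → 𝒵) : Prop :=
  ∃ Rz : 𝒵 → Measure Ω,
    (∀ z, SigmaFinite (Rz z)) ∧
    (∀ A, MeasurableSet A → Measurable fun z => Rz z A) ∧
    (∀ A, MeasurableSet A → R A = ∫⁻ z, Rz z A ∂(R.map Z)) ∧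
    ∀ᵐ z ∂(R.map Z), Rz z (Z ⁻¹' {z})ᶜ = 0

/-- `Z` is a regular sufficient statistic for the model `Q`: there is a Markov kernel
`(z, A) ↦ P_z(A)` such that `P_Z(A)` is a version of `Q_θ(A | Z)` for all `θ` and `A`, and such that
`P_z(Z⁻¹{z}) = 1` for almost all `z` under the model. -/
def IsRegularSufficient {Θ Ω 𝒵 : Type*} [MeasurableSpace Ω] [MeasurableSpace 𝒵]
    (Q : Θ → Measure Ω) (Z : Ω → 𝒵) : Prop :=
  Measurable Z ∧
    ∃ κ : Kernel 𝒵 Ω, IsMarkovKernel κ ∧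
      (∀ θ A, MeasurableSet A →
        (fun ω => (κ (Z ω)).real A) =ᵐ[Q θ]
          (Q θ)[A.indicator (fun _ => (1 : ℝ)) | MeasurableSpace.comap Z inferInstance]) ∧
      ∀ θ, ∀ᵐ z ∂((Q θ).map Z), κ z (Z ⁻¹' {z}) = 1

/-- `Z` is a complete statistic for the model `Q`: for every measurable `f`, not necessarily
bounded, with `f(Z)` integrable under every `Q_θ`, if `E_θ f(Z) = c` for all `θ`, then `f(z) = c`
for almost all `z` under the model. -/
def IsCompleteStatistic {Θ Ω 𝒵 : Type*} [MeasurableSpace Ω] [MeasurableSpace 𝒵]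
    (Q : Θ → Measure Ω) (Z : Ω → 𝒵) : Prop :=
  Measurable Z ∧
    ∀ f : 𝒵 → ℝ, Measurable f → (∀ θ, Integrable (fun ω => f (Z ω)) (Q θ)) →
      ∀ c : ℝ, (∀ θ, ∫ ω, f (Z ω) ∂(Q θ) = c) → ∀ θ, ∀ᵐ z ∂((Q θ).map Z), f z = c

/-- `p` is a (real-valued, nonnegative) version of the density of `P` with respect to `m`. -/
def IsDensity {Ω : Type*} [MeasurableSpace Ω] (p : Ω → ℝ) (P m : Measure Ω) : Prop :=
  Measurable p ∧ (∀ ω, 0 ≤ p ω) ∧ P = m.withDensity fun ω => ENNReal.ofReal (p ω)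

/-- The region `{(x, y) : p_π(y | x) > k_{Z(x, y)}}`, whose section at `x = (y₁, …, yₙ)` is
the prediction region for `Yₙ₊₁`. Here `pX` and `pXY` are the prior predictive densities of
`X` and of `(X, Yₙ₊₁)`, and `p_π(y | x) = pXY(x, y) / pX(x)` is the posterior predictive density. -/
def predictiveRegion {𝒴 : Type*} [MeasurableSpace 𝒴] (n : ℕ) (pX : (Fin n → 𝒴) → ℝ)
    (pXY : (Fin n → 𝒴) × 𝒴 → ℝ) (k : WeakLaw 𝒴 → ℝ) : Set ((Fin n → 𝒴) × 𝒴) :=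
  {ω | k (empirical n ω) < pXY ω / pX ω.1}

end

/-! The symmetric group on n + 1 letters permutes the observations, and the fibers of the empirical
distribution Z are exactly its orbits (`empirical_permute`, `exists_permute_of_empirical_eq`). Each
claim about the model thus becomes a claim about permutation-invariant functions.

Disintegration: a positive weight that depends on Z alone turns R into a finite measure with the
same conditional laws. These exist on a standard Borel space, and they sit on the fibers because the
graph of Z is measurable.

Sufficiency: relative to a law P₀ equivalent to μ, the density of P^{n+1} is a symmetric product,
hence a function of Z. One disintegration of P₀^{n+1} then serves every P.

Completeness: if g is symmetric with mean zero under the model, rescaling gives ∫ g ∏ h(yᵢ) = 0 for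
all bounded h ≥ 0. Polarization by Ryser's formula replaces ∏ h(yᵢ) by the symmetrized indicator of
a rectangle, and the symmetry of g removes the symmetrization (`ae_eq_zero_of_symmetric`).

Optimality: completeness, applied to the orbit sum of 1_A - 1_{A^π}, shows that A and A^π select
equally many permutations on almost every orbit. The joint predictive density is constant on orbits,
so A^π selects the points where p_π(x) is small. This is a finite Neyman–Pearson problem
(`sum_ite_le_of_threshold`), and integrating over the orbits gives the inequality between the risks.
-/

noncomputable section

/-! ### Disintegration along a statistic with values in a countably separated space -/

section Disintegration

variable {Ω 𝒵 : Type*} [MeasurableSpace Ω] [MeasurableSpace 𝒵]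

/-- A measurable injection into the Cantor space reduces equality in `𝒵` to equality in a space with
measurable diagonal. -/
theorem measurableSet_graph_of_countablySeparated [MeasurableSpace.CountablySeparated 𝒵]
    {Z : Ω → 𝒵} (hZ : Measurable Z) : MeasurableSet {p : 𝒵 × Ω | Z p.2 = p.1} := by
  obtain ⟨f, hf, hinj⟩ := MeasurableSpace.measurable_injection_nat_bool_of_countablySeparated 𝒵
  have e : {p : 𝒵 × Ω | Z p.2 = p.1} = {p : 𝒵 × Ω | f (Z p.2) = f p.1} := by
    ext p
    exact hinj.eq_iff.symm
  rw [e]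
  exact measurableSet_eq_fun (hf.comp (hZ.comp measurable_snd)) (hf.comp measurable_fst)

theorem map_withDensity_comp (R : Measure Ω) {Z : Ω → 𝒵} (hZ : Measurable Z) {l : 𝒵 → ℝ≥0∞}
    (hl : Measurable l) :
    (R.withDensity fun ω => l (Z ω)).map Z = (R.map Z).withDensity l := by
  ext s hs
  rw [Measure.map_apply hZ hs, withDensity_apply _ (hZ hs), withDensity_apply _ hs,
    setLIntegral_map hs hl hZ]

/-- A kernel that disintegrates `R` along `Z` also disintegrates every measure with a density that
is a function of `Z`. -/
theorem map_graph_withDensity_comp (R : Measure Ω) {Z : Ω → 𝒵} (hZ : Measurable Z)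
    [SFinite (R.map Z)] {κ : Kernel 𝒵 Ω} [IsSFiniteKernel κ]
    (hκ : R.map (fun ω => (Z ω, ω)) = R.map Z ⊗ₘ κ) {l : 𝒵 → ℝ≥0∞} (hl : Measurable l) :
    (R.withDensity fun ω => l (Z ω)).map (fun ω => (Z ω, ω)) =
      (R.withDensity fun ω => l (Z ω)).map Z ⊗ₘ κ := by
  have hpair : Measurable fun ω => (Z ω, ω) := hZ.prodMk measurable_id
  rw [map_withDensity_comp R hZ hl]
  have h := map_withDensity_comp R hpair (hl.comp measurable_fst)
  simp only [Function.comp_def] at h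
  rw [h, hκ]
  ext s hs
  rw [withDensity_apply _ hs, Measure.compProd_apply hs, ← lintegral_indicator hs,
    Measure.lintegral_compProd (Measurable.indicator (f := fun p : 𝒵 × Ω => l p.1)
      (hl.comp measurable_fst) hs),
    lintegral_withDensity_eq_lintegral_mul _ hl (Kernel.measurable_kernel_prodMk_left hs)]
  refine lintegral_congr fun z => ?_
  rw [Pi.mul_apply, ← lintegral_indicator_one (measurable_prodMk_left hs),
    ← lintegral_const_mul _ (measurable_one.indicator (measurable_prodMk_left hs))]
  refine lintegral_congr fun ω => ?_
  by_cases hω : (z, ω) ∈ s <;> simp [hω, Set.indicator]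

/-- A disintegration given by a Markov kernel, concentrated on the fibers of the statistic. -/
theorem exists_markovKernel_disintegration [StandardBorelSpace Ω] [Nonempty Ω]
    [MeasurableSpace.CountablySeparated 𝒵] (R : Measure Ω) {Z : Ω → 𝒵} (hZ : Measurable Z)
    [SigmaFinite (R.map Z)] :
    ∃ κ : Kernel 𝒵 Ω, IsMarkovKernel κ ∧ R.map (fun ω => (Z ω, ω)) = R.map Z ⊗ₘ κ ∧
      ∀ᵐ z ∂(R.map Z), κ z (Z ⁻¹' {z})ᶜ = 0 := by
  -- The weight g(Z) makes `R'` finite; being positive and finite, it can be divided out again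
  -- without changing the kernel.
  obtain ⟨g, hpos, hg, hint⟩ := exists_pos_lintegral_lt_of_sigmaFinite (R.map Z) one_ne_zero
  have hg' : Measurable fun z => (g z : ℝ≥0∞) := hg.coe_nnreal_ennreal
  rw [lintegral_map hg' hZ] at hint
  set R' := R.withDensity fun ω => (g (Z ω) : ℝ≥0∞) with hR'
  have : IsFiniteMeasure R' := isFiniteMeasure_withDensity hint.ne_top
  have hRR' : R = R'.withDensity fun ω => (g (Z ω) : ℝ≥0∞)⁻¹ :=
    (withDensity_inv_same (hg'.comp hZ) (ae_of_all _ fun ω => by simpa using (hpos (Z ω)).ne')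
      (ae_of_all _ fun ω => ENNReal.coe_ne_top)).symm
  have hdis : R.map (fun ω => (Z ω, ω)) = R.map Z ⊗ₘ condDistrib id Z R' := by
    have h := map_graph_withDensity_comp R' hZ
      (compProd_map_condDistrib (μ := R') (X := Z) aemeasurable_id).symm hg'.inv
    simp only [Pi.inv_apply] at h
    rwa [← hRR'] at h
  refine ⟨condDistrib id Z R', inferInstance, hdis, ?_⟩
  have hG := (measurableSet_graph_of_countablySeparated hZ).compl
  have h0 : (R.map Z ⊗ₘ condDistrib id Z R') {p : 𝒵 × Ω | Z p.2 = p.1}ᶜ = 0 := by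
    rw [← hdis, Measure.map_apply (show Measurable fun ω => (Z ω, ω) from hZ.prodMk measurable_id) hG]
    simp
  rw [Measure.compProd_apply hG,
    lintegral_eq_zero_iff (Kernel.measurable_kernel_prodMk_left hG)] at h0
  exact h0

theorem hasDisintegration_of_sigmaFinite_map [StandardBorelSpace Ω] [Nonempty Ω]
    [MeasurableSpace.CountablySeparated 𝒵] (R : Measure Ω) {Z : Ω → 𝒵} (hZ : Measurable Z)
    [SigmaFinite (R.map Z)] : HasDisintegration R Z := by
  obtain ⟨κ, _, hκ, hfib⟩ := exists_markovKernel_disintegration R hZ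
  refine ⟨fun z => κ z, fun z => inferInstance, fun A hA => κ.measurable_coe hA, fun A hA => ?_,
    hfib⟩
  have h := congrArg (fun m : Measure (𝒵 × Ω) => m (Prod.snd ⁻¹' A)) hκ
  rw [Measure.map_apply (show Measurable fun ω => (Z ω, ω) from hZ.prodMk measurable_id)
      (measurable_snd hA),
    Measure.compProd_apply (measurable_snd hA)] at h
  exact h

/-- A measurable function that is constant on the fibers of `Z` is a measurable function of `Z`. -/
theorem exists_measurable_factor [StandardBorelSpace Ω] [MeasurableSpace.CountablySeparated 𝒵]
    {Z : Ω → 𝒵} (hZ : Measurable Z) {L : Ω → ℝ≥0∞} (hL : Measurable L)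
    (hfib : ∀ ω ω', Z ω = Z ω' → L ω = L ω') :
    ∃ l : 𝒵 → ℝ≥0∞, Measurable l ∧ L = l ∘ Z := by
  have h : Measurable[MeasurableSpace.comap Z inferInstance] L := by
    intro s hs
    have hsat : Z ⁻¹' (Z '' (L ⁻¹' s)) = L ⁻¹' s := by
      refine Set.Subset.antisymm ?_ (Set.subset_preimage_image _ _)
      rintro ω ⟨ω', hω', hZω⟩
      have := hfib _ _ hZω
      simp only [Set.mem_preimage] at hω' ⊢
      rwa [← this]
    have : MeasurableSpace.CountablySeparated (Set.range Z) := by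
      exact MeasurableSpace.Subtype.countablySeparated
    -- Descriptive set theory enters here: for a measurable map from a standard Borel space to a
    -- countably separated one, a subset of the range with measurable preimage is itself measurable
    -- in the range.
    have h1 := (hZ.measurableSet_preimage_iff_preimage_val (s := Z '' (L ⁻¹' s))).1
      (by rw [hsat]; exact hL hs)
    obtain ⟨t, ht, hte⟩ := h1
    refine ⟨t, ht, ?_⟩
    rw [← hsat]
    ext ω
    have := congrArg (fun S : Set (Set.range Z) => (⟨Z ω, ω, rfl⟩ : Set.range Z) ∈ S) hte
    simpa using this
  obtain ⟨l, hl, rfl⟩ := h.exists_eq_measurable_comp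
  exact ⟨l, hl, rfl⟩

end Disintegration

/-! ### Coordinates of a sample and their permutations -/

section Coordinates

variable {𝒴 : Type*} [MeasurableSpace 𝒴] {n : ℕ}

/-- The `n + 1` observations as a tuple. -/
def coords (n : ℕ) : ((Fin n → 𝒴) × 𝒴) ≃ᵐ (Fin (n + 1) → 𝒴) :=
  MeasurableEquiv.prodComm.trans
    (MeasurableEquiv.piFinSuccAbove (fun _ => 𝒴) (Fin.last n)).symm

theorem coords_castSucc (ω : (Fin n → 𝒴) × 𝒴) (i : Fin n) : coords n ω i.castSucc = ω.1 i := by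
  have := Fin.insertNth_apply_succAbove (α := fun _ => 𝒴) (Fin.last n) ω.2 ω.1 i
  rwa [Fin.succAbove_last] at this

theorem coords_last (ω : (Fin n → 𝒴) × 𝒴) : coords n ω (Fin.last n) = ω.2 :=
  Fin.insertNth_apply_same (α := fun _ => 𝒴) (Fin.last n) ω.2 ω.1

theorem measurePreserving_coords (m : Measure 𝒴) [SigmaFinite m] :
    MeasurePreserving (coords n) ((Measure.pi fun _ : Fin n => m).prod m)
      (Measure.pi fun _ : Fin (n + 1) => m) :=
  ((measurePreserving_piFinSuccAbove (fun _ : Fin (n + 1) => m) (Fin.last n)).symm _).comp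
    Measure.measurePreserving_swap

/-- The sample with its observations permuted. -/
def permute (σ : Equiv.Perm (Fin (n + 1))) : ((Fin n → 𝒴) × 𝒴) ≃ᵐ ((Fin n → 𝒴) × 𝒴) :=
  -- `piCongrLeft` moves the entry at index i to its image, so the inverse makes coordinate i of the
  -- result read coordinate `σ i`.
  ((coords n).trans (MeasurableEquiv.piCongrLeft (fun _ => 𝒴) σ.symm)).trans (coords n).symm

theorem coords_permute (σ : Equiv.Perm (Fin (n + 1))) (ω : (Fin n → 𝒴) × 𝒴) (i : Fin (n + 1)) :
    coords n (permute σ ω) i = coords n ω (σ i) := by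
  have h : coords n (permute σ ω) =
      MeasurableEquiv.piCongrLeft (fun _ => 𝒴) σ.symm (coords n ω) :=
    (coords n).apply_symm_apply _
  rw [h, MeasurableEquiv.coe_piCongrLeft]
  simpa using Equiv.piCongrLeft_apply_apply (fun _ => 𝒴) σ.symm (coords n ω) (σ i)

/-- Reindexing is a right action, which reverses the order of composition. -/
theorem permute_permute (σ τ : Equiv.Perm (Fin (n + 1))) (ω : (Fin n → 𝒴) × 𝒴) :
    permute σ (permute τ ω) = permute (τ * σ) ω := by
  refine (coords n).injective (funext fun i => ?_)
  simp [coords_permute]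

theorem permute_one (ω : (Fin n → 𝒴) × 𝒴) : permute 1 ω = ω := by
  refine (coords n).injective (funext fun i => ?_)
  simp [coords_permute]

theorem measurePreserving_permute (m : Measure 𝒴) [SigmaFinite m]
    (σ : Equiv.Perm (Fin (n + 1))) :
    MeasurePreserving (permute σ) ((Measure.pi fun _ : Fin n => m).prod m)
      ((Measure.pi fun _ : Fin n => m).prod m) :=
  ((measurePreserving_coords m).symm _).comp
    ((measurePreserving_piCongrLeft (fun _ : Fin (n + 1) => m) σ.symm).comp
      (measurePreserving_coords m))

end Coordinates

/-! ### Borel probability measures with the weak topology -/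

namespace WeakLaw

variable {𝒴 : Type*} [MeasurableSpace 𝒴]

/-- The underlying measure. -/
def toMeasure (z : WeakLaw 𝒴) : Measure 𝒴 := ProbabilityMeasure.toMeasure z

instance (z : WeakLaw 𝒴) : IsProbabilityMeasure z.toMeasure :=
  z.2

theorem toMeasure_injective : Function.Injective (toMeasure : WeakLaw 𝒴 → Measure 𝒴) :=
  fun _ _ h => Subtype.ext h

theorem measurable_toMeasure [TopologicalSpace 𝒴] [BorelSpace 𝒴] [HasOuterApproxClosed 𝒴] :
    Measurable (toMeasure : WeakLaw 𝒴 → Measure 𝒴) := by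
  refine Measurable.measure_of_isPiSystem_of_isProbabilityMeasure
    (S := {s | IsClosed s}) ?_ isPiSystem_isClosed ?_
  · rw [BorelSpace.measurable_eq (α := 𝒴), borel_eq_generateFrom_isClosed]
  · intro F hF
    have hF' : IsClosed F := hF
    refine ENNReal.measurable_of_tendsto (f := fun m z => ∫⁻ y, hF'.apprSeq m y ∂z.toMeasure)
      (fun m => ?_) ?_
    · have h := ENNReal.continuous_coe.comp
        (ProbabilityMeasure.continuous_testAgainstNN_eval (hF'.apprSeq m))
      have h' := Continuous.measurable (α := WeakLaw 𝒴) h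
      have e : (fun z : WeakLaw 𝒴 => ∫⁻ y, hF'.apprSeq m y ∂z.toMeasure) =
          fun z : WeakLaw 𝒴 =>
            (((show ProbabilityMeasure 𝒴 from z).toFiniteMeasure.testAgainstNN
              (hF'.apprSeq m) : ℝ≥0) : ℝ≥0∞) := by
        funext z
        exact (FiniteMeasure.testAgainstNN_coe_eq
          (μ := (show ProbabilityMeasure 𝒴 from z).toFiniteMeasure) (f := hF'.apprSeq m)).symm
      rw [e]
      exact h'
    · rw [tendsto_pi_nhds]
      intro z
      exact HasOuterApproxClosed.tendsto_lintegral_apprSeq hF' z.toMeasure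

theorem measurable_apply [TopologicalSpace 𝒴] [BorelSpace 𝒴] [HasOuterApproxClosed 𝒴]
    {B : Set 𝒴} (hB : MeasurableSet B) : Measurable fun z : WeakLaw 𝒴 => z.toMeasure B :=
  (Measure.measurable_coe hB).comp measurable_toMeasure

/-- A probability measure is determined by its values on a countable generating algebra, and these
values by their comparisons with rationals. -/
instance [TopologicalSpace 𝒴] [BorelSpace 𝒴] [HasOuterApproxClosed 𝒴]
    [MeasurableSpace.CountablyGenerated 𝒴] : MeasurableSpace.CountablySeparated (WeakLaw 𝒴) := by
  refine ⟨⟨⋃ B ∈ generateSetAlgebra (MeasurableSpace.countableGeneratingSet 𝒴),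
    ⋃ q : ℚ, {{z : WeakLaw 𝒴 | z.toMeasure B < ENNReal.ofReal q}}, ?_, ?_, ?_⟩⟩
  · refine Set.Countable.biUnion ?_ fun B _ => Set.countable_iUnion fun q =>
      Set.countable_singleton _
    exact countable_generateSetAlgebra MeasurableSpace.countable_countableGeneratingSet
  · intro s hs
    simp only [Set.mem_iUnion, Set.mem_singleton_iff] at hs
    obtain ⟨B, hB, q, rfl⟩ := hs
    refine measurableSet_lt (measurable_apply ?_) measurable_const
    have := MeasurableSpace.measurableSet_generateFrom hB
    rwa [generateFrom_generateSetAlgebra_eq,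
      MeasurableSpace.generateFrom_countableGeneratingSet] at this
  · intro z _ z' _ h
    refine toMeasure_injective (ext_of_generate_finite
      (generateSetAlgebra (MeasurableSpace.countableGeneratingSet 𝒴)) ?_
      (fun s hs t ht _ => isSetAlgebra_generateSetAlgebra.inter_mem hs ht) (fun B hB => ?_) (by simp))
    · rw [generateFrom_generateSetAlgebra_eq, MeasurableSpace.generateFrom_countableGeneratingSet]
    · have key : ∀ q : ℚ, z.toMeasure B < ENNReal.ofReal q ↔ z'.toMeasure B < ENNReal.ofReal q := by
        intro q
        refine h {z : WeakLaw 𝒴 | z.toMeasure B < ENNReal.ofReal q} ?_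
        simp only [Set.mem_iUnion, Set.mem_singleton_iff]
        exact ⟨B, hB, q, rfl⟩
      refine le_antisymm (le_of_not_gt fun hlt => ?_) (le_of_not_gt fun hlt => ?_)
      · obtain ⟨q, -, h1, h2⟩ := ENNReal.lt_iff_exists_rat_btwn.1 hlt
        exact lt_asymm h2 ((key q).2 h1)
      · obtain ⟨q, -, h1, h2⟩ := ENNReal.lt_iff_exists_rat_btwn.1 hlt
        exact lt_asymm h2 ((key q).1 h1)

end WeakLaw

/-! ### The empirical distribution -/

section Empirical

variable {𝒴 : Type*} [MeasurableSpace 𝒴] {n : ℕ}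

theorem toMeasure_empirical (ω : (Fin n → 𝒴) × 𝒴) :
    (empirical n ω).toMeasure =
      ((n + 1 : ℕ) : ℝ≥0∞)⁻¹ • ∑ i, Measure.dirac (coords n ω i) := by
  rw [Fin.sum_univ_castSucc, coords_last]
  simp only [coords_castSucc]
  rfl

theorem empirical_permute (σ : Equiv.Perm (Fin (n + 1))) (ω : (Fin n → 𝒴) × 𝒴) :
    empirical n (permute σ ω) = empirical n ω := by
  apply WeakLaw.toMeasure_injective
  rw [toMeasure_empirical, toMeasure_empirical]
  simp only [coords_permute]
  rw [Equiv.sum_comp σ fun i => Measure.dirac (coords n ω i)]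

/-- The mass of a singleton counts how often its point occurs. Equal multiplicities give bijections
between the index sets of each value, which glue to a permutation. -/
theorem exists_permute_of_empirical_eq [MeasurableSingletonClass 𝒴] {ω ω' : (Fin n → 𝒴) × 𝒴}
    (h : empirical n ω = empirical n ω') : ∃ σ, ω' = permute σ ω := by
  classical
  have hm := congrArg WeakLaw.toMeasure h
  rw [toMeasure_empirical, toMeasure_empirical] at hm
  have hcount : ∀ y, (Finset.univ.filter fun i => coords n ω i = y).card =
      (Finset.univ.filter fun i => coords n ω' i = y).card := by
    intro y
    have hy := congrArg (fun m : Measure 𝒴 => m {y}) hm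
    simp only [Measure.smul_apply, Measure.finsetSum_apply, smul_eq_mul,
      Measure.dirac_apply' _ (measurableSet_singleton y)] at hy
    rw [ENNReal.mul_right_inj (by simp) (by simp)] at hy
    simp only [Set.indicator_apply, Set.mem_singleton_iff, Pi.one_apply, Finset.sum_boole] at hy
    exact_mod_cast hy
  have hfib : ∀ y, Nonempty ({i // coords n ω' i = y} ≃ {i // coords n ω i = y}) := by
    intro y
    refine ⟨Fintype.equivOfCardEq ?_⟩
    rw [Fintype.card_subtype, Fintype.card_subtype, hcount]
  refine ⟨Equiv.ofFiberEquiv fun y => (hfib y).some, (coords n).injective (funext fun i => ?_)⟩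
  rw [coords_permute]
  exact (Equiv.ofFiberEquiv_map (fun y => (hfib y).some) i).symm

theorem continuous_empirical [TopologicalSpace 𝒴] [OpensMeasurableSpace 𝒴] :
    Continuous (empirical n : (Fin n → 𝒴) × 𝒴 → WeakLaw 𝒴) := by
  refine continuous_iff_continuousAt.2 fun ω => ?_
  refine (ProbabilityMeasure.tendsto_iff_forall_integral_tendsto (Ω := 𝒴)).2 fun f => ?_
  have key : ∀ ω, ∫ y, f y ∂(empirical n ω).toMeasure =
      ((n + 1 : ℕ) : ℝ)⁻¹ * (∑ i, f (ω.1 i) + f ω.2) := by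
    intro ω
    rw [toMeasure_empirical, integral_smul_measure, integral_finsetSum_measure]
    · rw [Fin.sum_univ_castSucc]
      simp only [coords_castSucc, coords_last]
      have hd : ∀ y, ∫ x, f x ∂(Measure.dirac y) = f y := fun y =>
        integral_dirac' _ _ f.continuous.stronglyMeasurable
      simp only [hd, ENNReal.toReal_inv, ENNReal.toReal_natCast, smul_eq_mul]
    · exact fun i _ => f.integrable _
  have hc : Continuous fun ω : (Fin n → 𝒴) × 𝒴 =>
      ((n + 1 : ℕ) : ℝ)⁻¹ * (∑ i, f (ω.1 i) + f ω.2) := by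
    fun_prop
  have := hc.tendsto ω
  rw [← key] at this
  exact this.congr fun ω' => (key ω').symm

end Empirical

/-! ### The risk measure and its image under the empirical distribution -/

section Risk

variable {𝒴 : Type*} [MeasurableSpace 𝒴] [TopologicalSpace 𝒴] {n : ℕ}

instance isProbabilityMeasure_xPredictive [BorelSpace 𝒴] [HasOuterApproxClosed 𝒴] {μ : Measure 𝒴}
    (π : Measure (DominatedLaw μ)) [IsProbabilityMeasure π] :
    IsProbabilityMeasure (xPredictive n π) :=
  isProbabilityMeasure_bind (measurable_xLaw μ n).aemeasurable (ae_of_all _ fun _ => inferInstance)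

/-- The laws carried by the k-th spanning set of `μ` pull back to samples lying entirely in that
set. Since `ρ` is finite, bounding the last observation alone already gives finite measure. -/
theorem sigmaFinite_map_empirical [BorelSpace 𝒴] [HasOuterApproxClosed 𝒴]
    (hZ : Measurable (empirical n : (Fin n → 𝒴) × 𝒴 → WeakLaw 𝒴))
    (ρ : Measure (Fin n → 𝒴)) [IsFiniteMeasure ρ] (μ : Measure 𝒴) [SigmaFinite μ] :
    SigmaFinite ((ρ.prod μ).map (empirical n)) := by
  let S : ℕ → Set (WeakLaw 𝒴) := fun k => {z | z.toMeasure (spanningSets μ k)ᶜ = 0}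
  have hS : ∀ k, MeasurableSet (S k) := fun k =>
    WeakLaw.measurable_apply (measurableSet_spanningSets μ k).compl (measurableSet_singleton 0)
  have hmem : ∀ ω k, empirical n ω ∈ S k ↔ ∀ i, coords n ω i ∈ spanningSets μ k := by
    intro ω k
    simp only [S, Set.mem_ofPred_eq, toMeasure_empirical, Measure.smul_apply,
      Measure.finsetSum_apply, smul_eq_mul, mul_eq_zero, Finset.sum_eq_zero_iff, Finset.mem_univ,
      true_imp_iff, Measure.dirac_apply' _ (measurableSet_spanningSets μ k).compl]
    simp
  have hcover : empirical n ⁻¹' (⋃ k, S k)ᶜ = ∅ := by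
    refine Set.eq_empty_of_forall_notMem fun ω hω => hω ?_
    refine Set.mem_iUnion.2 ⟨Finset.univ.sup fun i => spanningSetsIndex μ (coords n ω i),
      (hmem _ _).2 fun i => ?_⟩
    exact monotone_spanningSets μ (Finset.le_sup (f := fun i => spanningSetsIndex μ (coords n ω i))
      (Finset.mem_univ i)) (mem_spanningSetsIndex μ _)
  -- The added complement makes the sets cover all laws; it contains no empirical distribution, so
  -- it is null.
  refine ⟨⟨⟨fun k => S k ∪ (⋃ k, S k)ᶜ, fun _ => trivial, fun k => ?_, ?_⟩⟩⟩
  · refine (measure_union_le _ _).trans_lt ?_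
    rw [Measure.map_apply hZ (MeasurableSet.iUnion hS).compl, hcover, measure_empty, add_zero,
      Measure.map_apply hZ (hS k)]
    refine lt_of_le_of_lt (measure_mono (t := Set.univ ×ˢ spanningSets μ k) fun ω hω => ?_) ?_
    · have := (hmem ω k).1 hω (Fin.last n)
      rw [coords_last] at this
      exact ⟨trivial, this⟩
    · rw [Measure.prod_prod]
      exact ENNReal.mul_lt_top (measure_lt_top _ _) (measure_spanningSets_lt_top μ k)
  · rw [← Set.iUnion_union, Set.union_compl_self]

end Risk

/-! ### Densities of sampling distributions -/

theorem pi_withDensity {𝒴 ι : Type*} [MeasurableSpace 𝒴] [Fintype ι] (m : Measure 𝒴)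
    [IsProbabilityMeasure m] {f : 𝒴 → ℝ≥0∞} (hf : Measurable f) [SigmaFinite (m.withDensity f)] :
    Measure.pi (fun _ : ι => m.withDensity f) =
      (Measure.pi fun _ : ι => m).withDensity fun y => ∏ i, f (y i) := by
  refine Measure.pi_eq fun s hs => ?_
  have hmeas : ∀ i, Measurable ((s i).indicator f) := fun i => hf.indicator (hs i)
  have hind := iIndepFun_pi (μ := fun _ : ι => m) (X := fun i => (s i).indicator f)
    fun i => (hmeas i).aemeasurable
  have h := lintegral_prod_eq_prod_lintegral_of_indepFun Finset.univ _ hind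
    fun i => (hmeas i).comp (measurable_pi_apply i)
  rw [withDensity_apply _ (MeasurableSet.univ_pi hs),
    ← lintegral_indicator (MeasurableSet.univ_pi hs)]
  refine Eq.trans (lintegral_congr fun y => ?_) (h.trans (Finset.prod_congr rfl fun i _ => ?_))
  · by_cases hy : y ∈ Set.univ.pi s
    · rw [Set.indicator_of_mem hy]
      exact Finset.prod_congr rfl fun i _ => (Set.indicator_of_mem (hy i trivial) _).symm
    · rw [Set.indicator_of_notMem hy]
      simp only [Set.mem_pi, Set.mem_univ, true_imp_iff, not_forall] at hy
      obtain ⟨i, hi⟩ := hy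
      exact (Finset.prod_eq_zero (Finset.mem_univ i) (Set.indicator_of_notMem hi _)).symm
  · rw [withDensity_apply _ (hs i), ← lintegral_indicator (hs i)]
    exact (measurePreserving_eval (fun _ : ι => m) i).lintegral_comp (hmeas i)

section Sufficiency

variable {𝒴 : Type*} [MeasurableSpace 𝒴] {n : ℕ} {μ : Measure 𝒴}

theorem map_coords_sampleLaw (P : DominatedLaw μ) :
    (sampleLaw n P).map (coords n) = Measure.pi fun _ => P.toMeasure :=
  (measurePreserving_coords P.toMeasure).map_eq

theorem sampleLaw_eq_withDensity {P P₀ : DominatedLaw μ} {f : 𝒴 → ℝ≥0∞} (hf : Measurable f)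
    (h : P.toMeasure = P₀.toMeasure.withDensity f) :
    sampleLaw n P = (sampleLaw n P₀).withDensity fun ω => ∏ i, f (coords n ω i) := by
  have hF : Measurable fun y : Fin (n + 1) → 𝒴 => ∏ i, f (y i) :=
    Finset.measurable_prod _ fun i _ => hf.comp (measurable_pi_apply i)
  have : SigmaFinite (P₀.toMeasure.withDensity f) := h ▸ inferInstance
  apply (coords n).map_measurableEquiv_injective
  rw [map_withDensity_comp _ (coords n).measurable hF, map_coords_sampleLaw,
    map_coords_sampleLaw, h, pi_withDensity _ hf]

theorem DominatedLaw.absolutelyContinuous (P : DominatedLaw μ) : P.toMeasure ≪ μ := P.2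

/-- The model contains a law that is equivalent to `μ`. -/
theorem exists_dominatedLaw_equiv [SigmaFinite μ] (P : DominatedLaw μ) :
    ∃ P₀ : DominatedLaw μ, μ ≪ P₀.toMeasure := by
  have : NeZero μ := ⟨fun h => by
    have h1 : P.toMeasure Set.univ = 0 := P.absolutelyContinuous (by simp [h])
    simp at h1⟩
  exact ⟨⟨⟨μ.toFinite, inferInstance⟩, toFinite_absolutelyContinuous μ⟩,
    absolutelyContinuous_toFinite μ⟩

/-- Factorization criterion: every P^{n+1} has a density with respect to P₀^{n+1} that is a function
of the statistic, so the kernel obtained from P₀ is common to all P. -/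
theorem isRegularSufficient_empirical [SigmaFinite μ] [TopologicalSpace 𝒴] [PolishSpace 𝒴]
    [BorelSpace 𝒴] [HasOuterApproxClosed 𝒴]
    (hZ : Measurable (empirical n : (Fin n → 𝒴) × 𝒴 → WeakLaw 𝒴)) (P₁ : DominatedLaw μ) :
    IsRegularSufficient (sampleLaw n : DominatedLaw μ → Measure ((Fin n → 𝒴) × 𝒴))
      (empirical n) := by
  obtain ⟨P₀, hP₀⟩ := exists_dominatedLaw_equiv P₁
  have := nonempty_of_isProbabilityMeasure (sampleLaw n P₀)
  have := Measure.isProbabilityMeasure_map (μ := sampleLaw n P₀) hZ.aemeasurable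
  obtain ⟨κ, _, hκ, hfib⟩ := exists_markovKernel_disintegration (sampleLaw n P₀) hZ
  have key : ∀ P : DominatedLaw μ, ∃ l : WeakLaw 𝒴 → ℝ≥0∞, Measurable l ∧
      sampleLaw n P = (sampleLaw n P₀).withDensity fun ω => l (empirical n ω) := by
    intro P
    have hf := Measure.measurable_rnDeriv P.toMeasure P₀.toMeasure
    have h := sampleLaw_eq_withDensity (n := n) hf (Measure.withDensity_rnDeriv_eq _ _
      (P.absolutelyContinuous.trans hP₀)).symm
    obtain ⟨l, hl, hL⟩ := exists_measurable_factor hZ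
      (L := fun ω => ∏ i, P.toMeasure.rnDeriv P₀.toMeasure (coords n ω i))
      (Finset.measurable_prod _ fun i _ =>
        hf.comp ((measurable_pi_apply i).comp (coords n).measurable))
      (fun ω ω' hω => by
        obtain ⟨σ, rfl⟩ := exists_permute_of_empirical_eq hω
        simp only [coords_permute]
        exact (Equiv.prod_comp σ fun i =>
          P.toMeasure.rnDeriv P₀.toMeasure (coords n ω i)).symm)
    exact ⟨l, hl, by rw [h, hL]; rfl⟩
  refine ⟨hZ, κ, inferInstance, fun P A hA => ?_, fun P => ?_⟩
  · obtain ⟨l, hl, hP⟩ := key P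
    have h := map_graph_withDensity_comp (sampleLaw n P₀) hZ hκ hl
    rw [← hP] at h
    have h1 := condDistrib_ae_eq_of_measure_eq_compProd (μ := sampleLaw n P) (empirical n)
      aemeasurable_id h
    have h2 := condDistrib_ae_eq_condExp (μ := sampleLaw n P) hZ measurable_id hA
    filter_upwards [ae_of_ae_map hZ.aemeasurable h1, h2] with ω hω1 hω2
    rw [← hω1]
    exact hω2
  · obtain ⟨l, hl, hP⟩ := key P
    have hac : (sampleLaw n P).map (empirical n) ≪ (sampleLaw n P₀).map (empirical n) := by
      rw [hP]
      exact (withDensity_absolutelyContinuous _ _).map hZ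
    filter_upwards [hac.ae_le hfib] with z hz
    have := MeasurableSpace.measurableSingletonClass_of_countablySeparated (α := WeakLaw 𝒴)
    have hm : MeasurableSet (empirical n ⁻¹' {z} : Set ((Fin n → 𝒴) × 𝒴)) :=
      hZ (measurableSet_singleton z)
    exact (prob_compl_eq_zero_iff hm).1 hz

end Sufficiency

/-! ### Completeness of the symmetric statistics -/

/-- Ryser's formula for the permanent. -/
theorem sum_neg_one_pow_card_mul_prod_sum {ι R : Type*} [Fintype ι] [DecidableEq ι] [CommRing R]
    (a : ι → ι → R) :
    ∑ S : Finset ι, (-1 : R) ^ S.card * ∏ i, ∑ j ∈ S, a i j =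
      (-1) ^ Fintype.card ι * ∑ σ : Equiv.Perm ι, ∏ i, a i (σ i) := by
  have hinner : ∀ φ : ι → ι, ∑ S : Finset ι, (if ∀ i, φ i ∈ S then (-1 : R) ^ S.card else 0) =
      if Function.Bijective φ then (-1) ^ Fintype.card ι else 0 := by
    intro φ
    -- Inclusion–exclusion as one product: the factor at j is -1 if j is in the image of `φ` and -1
    -- + 1 = 0 otherwise, so only surjective `φ` survive.
    have h := Finset.prod_add (fun _ : ι => (-1 : R))
      (fun j => if ∃ i, φ i = j then (0 : R) else 1) Finset.univ
    rw [Finset.powerset_univ] at h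
    have hS : ∀ S : Finset ι, (if ∀ i, φ i ∈ S then (-1 : R) ^ S.card else 0) =
        (∏ _i ∈ S, (-1 : R)) * ∏ j ∈ Finset.univ \ S, if ∃ i, φ i = j then (0 : R) else 1 := by
      intro S
      rw [Finset.prod_const]
      split_ifs with hφ
      · rw [Finset.prod_eq_one, mul_one]
        intro j hj
        refine if_neg ?_
        rintro ⟨i, rfl⟩
        exact (Finset.mem_sdiff.1 hj).2 (hφ i)
      · obtain ⟨i, hi⟩ := not_forall.1 hφ
        have hmem : φ i ∈ Finset.univ \ S := by simpa using hi
        rw [Finset.prod_eq_zero (f := fun j => if ∃ i, φ i = j then (0 : R) else 1) hmem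
          (if_pos ⟨i, rfl⟩), mul_zero]
    rw [Finset.sum_congr rfl fun S _ => hS S, ← h]
    split_ifs with hφ
    · rw [← Finset.card_univ, ← Finset.prod_const]
      refine Finset.prod_congr rfl fun j _ => ?_
      rw [if_pos (hφ.2 j), add_zero]
    · have hsurj : ¬ Function.Surjective φ := fun hs => hφ (Finite.injective_iff_surjective.2 hs |>
        fun hi => ⟨hi, hs⟩)
      obtain ⟨j, hj⟩ := not_forall.1 hsurj
      exact Finset.prod_eq_zero (Finset.mem_univ j) (by rw [if_neg hj]; ring)
  have hexp : ∀ S : Finset ι, (-1 : R) ^ S.card * ∏ i, ∑ j ∈ S, a i j =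
      ∑ φ : ι → ι, (if ∀ i, φ i ∈ S then (-1 : R) ^ S.card else 0) * ∏ i, a i (φ i) := by
    intro S
    rw [Finset.prod_univ_sum, Finset.mul_sum]
    simp only [ite_mul, zero_mul]
    rw [← Finset.sum_filter]
    refine Finset.sum_congr ?_ fun _ _ => rfl
    ext φ
    simp
  rw [Finset.sum_congr rfl fun S _ => hexp S, Finset.sum_comm]
  rw [Finset.sum_congr rfl fun φ _ => (Finset.sum_mul _ _ _).symm]
  simp only [hinner, ite_mul, zero_mul]
  rw [← Finset.sum_filter, Finset.mul_sum]
  refine (Finset.sum_bij (fun (σ : Equiv.Perm ι) _ => (σ : ι → ι)) ?_ ?_ ?_ ?_).symm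
  · intro σ _
    simp
  · intro σ _ τ _ h
    exact DFunLike.coe_injective h
  · intro φ hφ
    exact ⟨Equiv.ofBijective φ (Finset.mem_filter.1 hφ).2, Finset.mem_univ _, rfl⟩
  · exact fun _ _ => rfl

section Symmetric

variable {𝒴 ι : Type*} [MeasurableSpace 𝒴] [Fintype ι] {m : Measure 𝒴} {g : (ι → 𝒴) → ℝ}

theorem integrable_mul_prod (hint : Integrable g (Measure.pi fun _ : ι => m)) {h : ι → 𝒴 → ℝ}
    (hh : ∀ i, Measurable (h i)) {C : ℝ} (hC : ∀ i y, |h i y| ≤ C) :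
    Integrable (fun y => (∏ i, h i (y i)) * g y) (Measure.pi fun _ : ι => m) := by
  refine hint.bdd_mul (c := ∏ _i : ι, C) ?_ (ae_of_all _ fun y => ?_)
  · exact (Finset.measurable_prod _ fun i _ =>
      (hh i).comp (measurable_pi_apply i)).aestronglyMeasurable
  · rw [Real.norm_eq_abs, Finset.abs_prod]
    exact Finset.prod_le_prod (fun _ _ => abs_nonneg _) fun i _ => hC i (y i)

/-- By homogeneity, `h` may be divided by its integral and becomes a probability density; if the
integral is zero, the product vanishes almost surely. -/
theorem integral_prod_mul_eq_zero [IsProbabilityMeasure m] [Nonempty ι]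
    (hzero : ∀ f : 𝒴 → ℝ≥0∞, Measurable f → IsProbabilityMeasure (m.withDensity f) →
      ∫ y, g y ∂(Measure.pi fun _ : ι => m.withDensity f) = 0)
    {h : 𝒴 → ℝ≥0} (hh : Measurable h) {C : ℝ≥0} (hC : ∀ y, h y ≤ C) :
    ∫ y, (∏ i, (h (y i) : ℝ)) * g y ∂(Measure.pi fun _ : ι => m) = 0 := by
  have hh' : Measurable fun y => (h y : ℝ≥0∞) := hh.coe_nnreal_ennreal
  set c := ∫⁻ y, h y ∂m with hc
  have hctop : c ≠ ∞ := by
    refine ne_top_of_le_ne_top (b := (C : ℝ≥0∞)) ENNReal.coe_ne_top ?_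
    calc c ≤ ∫⁻ _, (C : ℝ≥0∞) ∂m := lintegral_mono fun y => ENNReal.coe_le_coe.2 (hC y)
      _ = C := by simp
  by_cases hc0 : c = 0
  · rw [hc, lintegral_eq_zero_iff hh'] at hc0
    obtain ⟨i⟩ := ‹Nonempty ι›
    refine integral_eq_zero_of_ae ?_
    have := (measurePreserving_eval (fun _ : ι => m) i).quasiMeasurePreserving.ae hc0
    filter_upwards [this] with y hy
    have hy' : h (y i) = 0 := by simpa using hy
    rw [Finset.prod_eq_zero (Finset.mem_univ i) (by simpa using hy')]
    simp
  · set f : 𝒴 → ℝ≥0∞ := fun y => c⁻¹ * h y with hf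
    have hfm : Measurable f := hh'.const_mul _
    have hprob : IsProbabilityMeasure (m.withDensity f) := by
      constructor
      rw [withDensity_apply _ MeasurableSet.univ, Measure.restrict_univ, lintegral_const_mul _ hh']
      exact ENNReal.inv_mul_cancel hc0 hctop
    have h0 := hzero f hfm hprob
    have hFm : Measurable fun y : ι → 𝒴 => ∏ i, f (y i) :=
      Finset.measurable_prod _ fun i _ => hfm.comp (measurable_pi_apply i)
    rw [pi_withDensity m hfm, integral_withDensity_eq_integral_toReal_smul hFm
      (ae_of_all _ fun y => ENNReal.prod_lt_top fun i _ =>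
        ENNReal.mul_lt_top (by simpa [pos_iff_ne_zero] using hc0) ENNReal.coe_lt_top)] at h0
    have e : ∀ y : ι → 𝒴, (∏ i, f (y i)).toReal • g y =
        c.toReal⁻¹ ^ Fintype.card ι * ((∏ i, (h (y i) : ℝ)) * g y) := by
      intro y
      simp only [hf, ENNReal.toReal_prod, ENNReal.toReal_mul, ENNReal.toReal_inv,
        ENNReal.coe_toReal, Finset.prod_mul_distrib, Finset.prod_const, Finset.card_univ,
        ENNReal.toReal_pow, smul_eq_mul, mul_assoc]
    simp only [e] at h0
    rw [integral_const_mul, mul_eq_zero] at h0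
    refine h0.resolve_left (pow_ne_zero _ (inv_ne_zero ?_))
    exact (ENNReal.toReal_pos hc0 hctop).ne'

/-- A symmetric function whose integrals vanish for all laws of i.i.d. samples from laws with a
density vanishes almost surely. -/
theorem ae_eq_zero_of_symmetric [IsProbabilityMeasure m] [Nonempty ι]
    (hint : Integrable g (Measure.pi fun _ : ι => m))
    (hsymm : ∀ (σ : Equiv.Perm ι) y, g (fun i => y (σ i)) = g y)
    (hzero : ∀ f : 𝒴 → ℝ≥0∞, Measurable f → IsProbabilityMeasure (m.withDensity f) →
      ∫ y, g y ∂(Measure.pi fun _ : ι => m.withDensity f) = 0) :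
    g =ᵐ[Measure.pi fun _ : ι => m] 0 := by
  classical
  have hrect : ∀ B : ι → Set 𝒴, (∀ i, MeasurableSet (B i)) →
      ∫ y in Set.univ.pi B, g y ∂(Measure.pi fun _ : ι => m) = 0 := by
    intro B hB
    let b : ι → 𝒴 → ℝ := fun j => (B j).indicator 1
    have hbm : ∀ j, Measurable (b j) := fun j => measurable_one.indicator (hB j)
    have hb01 : ∀ j y, 0 ≤ b j y ∧ b j y ≤ 1 := by
      intro j y
      by_cases hy : y ∈ B j <;> simp [b, hy]
    have hSm : ∀ S : Finset ι, Measurable fun y => ∑ j ∈ S, b j y := fun S =>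
      Finset.measurable_sum _ fun j _ => hbm j
    have hSpos : ∀ (S : Finset ι) y, 0 ≤ ∑ j ∈ S, b j y := fun S y =>
      Finset.sum_nonneg fun j _ => (hb01 j y).1
    have hSle : ∀ (S : Finset ι) y, ∑ j ∈ S, b j y ≤ S.card := fun S y =>
      (Finset.sum_le_sum fun j _ => (hb01 j y).2).trans (by simp)
    have hS0 : ∀ S : Finset ι,
        ∫ y, (∏ i, ∑ j ∈ S, b j (y i)) * g y ∂(Measure.pi fun _ : ι => m) = 0 := by
      intro S
      have := integral_prod_mul_eq_zero hzero (h := fun y => (∑ j ∈ S, b j y).toNNReal)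
        (hSm S).real_toNNReal (C := S.card) fun y => by
          rw [Real.toNNReal_le_iff_le_coe]; exact_mod_cast hSle S y
      simpa only [Real.coe_toNNReal _ (hSpos S _)] using this
    have hSint : ∀ S : Finset ι,
        Integrable (fun y => (∏ i, ∑ j ∈ S, b j (y i)) * g y) (Measure.pi fun _ : ι => m) :=
      fun S => integrable_mul_prod hint (h := fun _ y => ∑ j ∈ S, b j y) (fun _ => hSm S)
        (C := S.card) fun _ y => by rw [abs_of_nonneg (hSpos S y)]; exact hSle S y
    have hσint : ∀ σ : Equiv.Perm ι,
        Integrable (fun y => (∏ i, b (σ i) (y i)) * g y) (Measure.pi fun _ : ι => m) :=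
      fun σ => integrable_mul_prod hint (h := fun i => b (σ i)) (fun i => hbm _)
        (C := 1) fun i y => by rw [abs_of_nonneg (hb01 _ y).1]; exact (hb01 _ y).2
    -- Both `g` and the product measure are permutation-invariant, so all terms of the permanent
    -- have the same integral.
    have hσ : ∀ σ : Equiv.Perm ι,
        ∫ y, (∏ i, b (σ i) (y i)) * g y ∂(Measure.pi fun _ : ι => m) =
          ∫ y, (∏ i, b i (y i)) * g y ∂(Measure.pi fun _ : ι => m) := by
      intro σ
      rw [← (measurePreserving_piCongrLeft (fun _ : ι => m) σ).integral_comp'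
        (fun y => (∏ i, b i (y i)) * g y)]
      refine integral_congr_ae (ae_of_all _ fun y => ?_)
      have e : ∀ i, MeasurableEquiv.piCongrLeft (fun _ => 𝒴) σ y (σ i) = y i := fun i => by
        rw [MeasurableEquiv.coe_piCongrLeft]
        exact Equiv.piCongrLeft_apply_apply (fun _ => 𝒴) σ y i
      beta_reduce
      rw [← hsymm σ (MeasurableEquiv.piCongrLeft (fun _ => 𝒴) σ y),
        ← Equiv.prod_comp σ fun i => b i (MeasurableEquiv.piCongrLeft (fun _ => 𝒴) σ y i)]
      simp only [e]
    have hsum : ∫ y, ∑ S : Finset ι, (-1 : ℝ) ^ S.card * ((∏ i, ∑ j ∈ S, b j (y i)) * g y)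
        ∂(Measure.pi fun _ : ι => m) = 0 := by
      rw [integral_finsetSum _ fun S _ => (hSint S).const_mul _]
      exact Finset.sum_eq_zero fun S _ => by rw [integral_const_mul, hS0, mul_zero]
    have hryser : ∀ y : ι → 𝒴,
        ∑ S : Finset ι, (-1 : ℝ) ^ S.card * ((∏ i, ∑ j ∈ S, b j (y i)) * g y) =
          (-1) ^ Fintype.card ι * ∑ σ : Equiv.Perm ι, (∏ i, b (σ i) (y i)) * g y := by
      intro y
      rw [← Finset.sum_mul, ← mul_assoc,
        ← sum_neg_one_pow_card_mul_prod_sum fun i j => b j (y i), Finset.sum_mul]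
      simp only [mul_assoc]
    simp only [hryser] at hsum
    rw [integral_const_mul, integral_finsetSum _ fun σ _ => hσint σ,
      Finset.sum_congr rfl fun σ _ => hσ σ, Finset.sum_const, Finset.card_univ, mul_eq_zero,
      smul_eq_zero] at hsum
    have h0 := (hsum.resolve_left (pow_ne_zero _ (by norm_num))).resolve_left
      Fintype.card_ne_zero
    rw [← integral_indicator (MeasurableSet.univ_pi hB), ← h0]
    refine integral_congr_ae (ae_of_all _ fun y => ?_)
    beta_reduce
    by_cases hy : y ∈ Set.univ.pi B
    · rw [Set.indicator_of_mem hy, Finset.prod_eq_one, one_mul]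
      exact fun i _ => Set.indicator_of_mem (hy i trivial) _
    · rw [Set.indicator_of_notMem hy]
      simp only [Set.mem_pi, Set.mem_univ, true_imp_iff, not_forall] at hy
      obtain ⟨i, hi⟩ := hy
      rw [Finset.prod_eq_zero (Finset.mem_univ i) (Set.indicator_of_notMem hi _), zero_mul]
  have huniv : ∫ y, g y ∂(Measure.pi fun _ : ι => m) = 0 := by
    have := hrect (fun _ => Set.univ) fun _ => MeasurableSet.univ
    rwa [Set.pi_univ, setIntegral_univ] at this
  refine hint.ae_eq_zero_of_forall_setIntegral_eq_zero fun s hs _ => ?_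
  have hgen : MeasurableSpace.pi = MeasurableSpace.generateFrom
    (Set.pi Set.univ '' Set.pi Set.univ fun _ : ι => {s : Set 𝒴 | MeasurableSet s}) :=
    generateFrom_pi.symm
  induction s, hs using MeasurableSpace.induction_on_inter hgen isPiSystem_pi with
  | empty => simp
  | basic t ht =>
    obtain ⟨B, hB, rfl⟩ := ht
    exact hrect B fun i => hB i trivial
  | compl t ht ih =>
    have := integral_add_compl ht hint
    rw [ih (measure_lt_top _ _), huniv, zero_add] at this
    exact this
  | iUnion f hd hf ih =>
    rw [integral_iUnion hf hd hint.integrableOn]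
    simp [ih _ (measure_lt_top _ _)]

end Symmetric

theorem pi_absolutelyContinuous {𝒴 : Type*} [MeasurableSpace 𝒴] {m m' : Measure 𝒴} [SigmaFinite m]
    [SigmaFinite m'] (n : ℕ) (h : m ≪ m') :
    (Measure.pi fun _ : Fin n => m) ≪ Measure.pi fun _ : Fin n => m' := by
  induction n with
  | zero =>
    rw [Measure.pi_of_empty _ default, Measure.pi_of_empty _ default]
  | succ n ih =>
    rw [← ((measurePreserving_piFinSuccAbove (fun _ : Fin (n + 1) => m) 0).symm _).map_eq,
      ← ((measurePreserving_piFinSuccAbove (fun _ : Fin (n + 1) => m') 0).symm _).map_eq]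
    exact (h.prod ih).map (MeasurableEquiv.measurable _)

section Completeness

variable {𝒴 : Type*} [MeasurableSpace 𝒴] {n : ℕ} {μ : Measure 𝒴} [SigmaFinite μ]

theorem prod_absolutelyContinuous_sampleLaw {P₀ : DominatedLaw μ} (hP₀ : μ ≪ P₀.toMeasure) :
    (Measure.pi fun _ : Fin n => μ).prod μ ≪ sampleLaw n P₀ :=
  (pi_absolutelyContinuous n hP₀).prod hP₀

theorem sampleLaw_absolutelyContinuous (P : DominatedLaw μ) :
    sampleLaw n P ≪ (Measure.pi fun _ : Fin n => μ).prod μ :=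
  (pi_absolutelyContinuous n P.absolutelyContinuous).prod P.absolutelyContinuous

/-- A symmetric function with vanishing expectations under the model vanishes almost surely. -/
theorem ae_eq_zero_of_permute_invariant (P₁ : DominatedLaw μ) {g : (Fin n → 𝒴) × 𝒴 → ℝ}
    (hsymm : ∀ σ ω, g (permute σ ω) = g ω)
    (hint : ∀ P : DominatedLaw μ, Integrable g (sampleLaw n P))
    (hzero : ∀ P : DominatedLaw μ, ∫ ω, g ω ∂(sampleLaw n P) = 0) :
    g =ᵐ[(Measure.pi fun _ : Fin n => μ).prod μ] 0 := by
  obtain ⟨P₀, hP₀⟩ := exists_dominatedLaw_equiv P₁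
  refine (prod_absolutelyContinuous_sampleLaw hP₀).ae_eq ?_
  have hmp : ∀ P : DominatedLaw μ, MeasurePreserving (coords n).symm
      (Measure.pi fun _ => P.toMeasure) (sampleLaw n P) := fun P =>
    (measurePreserving_coords P.toMeasure).symm _
  have h := ae_eq_zero_of_symmetric (m := P₀.toMeasure) (g := g ∘ (coords n).symm)
    ((hmp P₀).integrable_comp_of_integrable (hint P₀)) (fun σ y => ?_) fun f hf hprob => ?_
  · have h' := (measurePreserving_coords P₀.toMeasure).quasiMeasurePreserving.ae h
    filter_upwards [h'] with ω hω
    simpa using hω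
  · rw [Function.comp_apply, Function.comp_apply, ← hsymm σ ((coords n).symm y)]
    congr 1
    refine (coords n).injective (funext fun i => ?_)
    simp [coords_permute]
  · let P : DominatedLaw μ := ⟨⟨P₀.toMeasure.withDensity f, hprob⟩,
      (withDensity_absolutelyContinuous _ _).trans P₀.absolutelyContinuous⟩
    have := (hmp P).integral_comp' g
    rw [hzero P] at this
    exact this

theorem isCompleteStatistic_empirical [TopologicalSpace 𝒴] [OpensMeasurableSpace 𝒴]
    (hZ : Measurable (empirical n : (Fin n → 𝒴) × 𝒴 → WeakLaw 𝒴)) :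
    IsCompleteStatistic (sampleLaw n : DominatedLaw μ → Measure ((Fin n → 𝒴) × 𝒴))
      (empirical n) := by
  refine ⟨hZ, fun f hf hint c hc P => ?_⟩
  have h := ae_eq_zero_of_permute_invariant P (n := n) (g := fun ω => f (empirical n ω) - c)
    (fun σ ω => by simp only [empirical_permute]) (fun P => (hint P).sub (integrable_const c))
    fun P => by rw [integral_sub (hint P) (integrable_const c), hc]; simp
  refine (ae_map_iff hZ.aemeasurable (hf (measurableSet_singleton c))).2 ?_
  filter_upwards [(sampleLaw_absolutelyContinuous P).ae_le h] with ω hω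
  exact sub_eq_zero.1 hω

end Completeness

/-! ### Optimality of the predictive regions -/

/-- Among the selections `a` with the same size as `b = {i | k < q / x i}`, the selection `b`
has the smallest total weight. -/
theorem sum_ite_le_of_threshold {ι : Type*} [Fintype ι] {x : ι → ℝ} (hx : ∀ i, 0 < x i) {q k : ℝ}
    (hq : 0 ≤ q) {a b : ι → Prop} [DecidablePred a] [DecidablePred b]
    (hb : ∀ i, b i ↔ k < q / x i)
    (hab : ∑ i, ((if a i then (1 : ℝ) else 0) - if b i then 1 else 0) = 0) :
    ∑ i, (if b i then x i else 0) ≤ ∑ i, (if a i then x i else 0) ∧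
      (∑ i, (if b i then x i else 0) = ∑ i, (if a i then x i else 0) → ∀ i, a i ↔ b i) := by
  set d : ι → ℝ := fun i => (if a i then (1 : ℝ) else 0) - if b i then 1 else 0 with hd
  have hd0 : (∀ i, d i = 0) → ∀ i, a i ↔ b i := by
    intro h i
    have := h i
    simp only [hd] at this
    clear hab h
    by_cases ha : a i <;> by_cases hbi : b i <;> simp [ha, hbi] at this ⊢
  have hpos : ∀ i, ¬ b i → 0 ≤ d i := by
    intro i hi
    simp only [hd, if_neg hi]
    split_ifs <;> norm_num
  have hneg : ∀ i, b i → d i ≤ 0 := by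
    intro i hi
    simp only [hd, if_pos hi]
    split_ifs <;> norm_num
  suffices h : (∀ i, a i ↔ b i) ∨
      0 ≤ ∑ i, x i * d i ∧ (∑ i, x i * d i = 0 → ∀ i, a i ↔ b i) by
    rcases h with h | h
    · exact ⟨by simp [h], fun _ => h⟩
    · have e : ∑ i, x i * d i =
          ∑ i, (if a i then x i else 0) - ∑ i, (if b i then x i else 0) := by
        rw [← Finset.sum_sub_distrib]
        exact Finset.sum_congr rfl fun i _ => by simp [hd, mul_sub]
      rw [e] at h
      exact ⟨sub_nonneg.1 h.1, fun h' => h.2 (sub_eq_zero.2 h'.symm)⟩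
  by_cases hk : 0 < k
  · right
    have hb' : ∀ i, b i ↔ k * x i < q := fun i => by rw [hb, lt_div_iff₀ (hx i)]
    -- The Neyman–Pearson inequality: both factors change sign together at the threshold, and the
    -- `q` part of the sum drops out because `d` sums to zero.
    have hterm : ∀ i, 0 ≤ (k * x i - q) * d i := by
      intro i
      by_cases hi : b i
      · exact mul_nonneg_of_nonpos_of_nonpos (sub_nonpos.2 ((hb' i).1 hi).le) (hneg i hi)
      · exact mul_nonneg (sub_nonneg.2 (not_lt.1 fun h => hi ((hb' i).2 h))) (hpos i hi)
    have hsum : ∑ i, (k * x i - q) * d i = k * ∑ i, x i * d i := by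
      simp only [sub_mul, Finset.sum_sub_distrib, ← Finset.mul_sum, hab, mul_zero, sub_zero,
        mul_assoc]
    have h0 : 0 ≤ k * ∑ i, x i * d i := hsum ▸ Finset.sum_nonneg fun i _ => hterm i
    refine ⟨nonneg_of_mul_nonneg_right h0 hk, fun h => hd0 ?_⟩
    rw [h, mul_zero, Finset.sum_eq_zero_iff_of_nonneg fun i _ => hterm i] at hsum
    have hnn : ∀ i, 0 ≤ d i := by
      intro i
      by_cases hi : b i
      · refine ge_of_eq ((mul_eq_zero.1 (hsum i (Finset.mem_univ i))).resolve_left ?_)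
        exact (sub_neg.2 ((hb' i).1 hi)).ne
      · exact hpos i hi
    exact fun i => (Finset.sum_eq_zero_iff_of_nonneg fun i _ => hnn i).1 hab i (Finset.mem_univ i)
  · left
    -- For k ≤ 0 the threshold selects all indices or none, so `d` has constant sign and, summing to
    -- zero, vanishes.
    have hconst : (∀ i, b i) ∨ ∀ i, ¬ b i := by
      rcases hq.eq_or_lt with rfl | hq'
      · by_cases hk' : k < 0
        · exact Or.inl fun i => (hb i).2 (by simpa using hk')
        · exact Or.inr fun i hi => hk' (by simpa using (hb i).1 hi)
      · exact Or.inl fun i => (hb i).2 ((not_lt.1 hk).trans_lt (div_pos hq' (hx i)))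
    refine hd0 fun i => ?_
    rcases hconst with h | h
    · exact (Finset.sum_eq_zero_iff_of_nonpos fun i _ => hneg i (h i)).1 hab i (Finset.mem_univ i)
    · exact (Finset.sum_eq_zero_iff_of_nonneg fun i _ => hpos i (h i)).1 hab i (Finset.mem_univ i)

section Optimality

variable {𝒴 : Type*} [MeasurableSpace 𝒴] {n : ℕ} {μ : Measure 𝒴}

theorem measurePreserving_permute_sampleLaw (P : DominatedLaw μ)
    (σ : Equiv.Perm (Fin (n + 1))) :
    MeasurePreserving (permute σ) (sampleLaw n P) (sampleLaw n P) :=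
  measurePreserving_permute P.toMeasure σ

theorem map_permute_samplePredictive [TopologicalSpace 𝒴] [BorelSpace 𝒴] [HasOuterApproxClosed 𝒴]
    (π : Measure (DominatedLaw μ))
    (σ : Equiv.Perm (Fin (n + 1))) :
    (samplePredictive n π).map (permute σ) = samplePredictive n π := by
  ext s hs
  rw [Measure.map_apply (permute σ).measurable hs, samplePredictive,
    Measure.bind_apply hs (measurable_sampleLaw μ n).aemeasurable,
    Measure.bind_apply ((permute σ).measurable hs) (measurable_sampleLaw μ n).aemeasurable]
  exact lintegral_congr fun P =>
    (measurePreserving_permute_sampleLaw P σ).measure_preimage hs.nullMeasurableSet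

variable [SigmaFinite μ]

/-- Regions of the same size under the model have the same number of members in almost all
orbits of the permutation action. -/
theorem ae_sum_indicator_permute_eq_zero (P₁ : DominatedLaw μ) {A B : Set ((Fin n → 𝒴) × 𝒴)}
    (hA : MeasurableSet A) (hB : MeasurableSet B)
    (h : ∀ P : DominatedLaw μ, sampleLaw n P A = sampleLaw n P B) :
    ∀ᵐ ω ∂((Measure.pi fun _ : Fin n => μ).prod μ),
      ∑ σ, (A.indicator (1 : (Fin n → 𝒴) × 𝒴 → ℝ) (permute σ ω) - B.indicator 1 (permute σ ω)) = 0 := by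
  have hA' : ∀ P : DominatedLaw μ, Integrable (A.indicator (1 : (Fin n → 𝒴) × 𝒴 → ℝ)) (sampleLaw n P) :=
    fun P => (integrable_const 1).indicator hA
  have hB' : ∀ P : DominatedLaw μ, Integrable (B.indicator (1 : (Fin n → 𝒴) × 𝒴 → ℝ)) (sampleLaw n P) :=
    fun P => (integrable_const 1).indicator hB
  have hint : ∀ (P : DominatedLaw μ) σ, Integrable
      (fun ω => A.indicator (1 : (Fin n → 𝒴) × 𝒴 → ℝ) (permute σ ω) - B.indicator 1 (permute σ ω))
      (sampleLaw n P) := fun P σ =>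
    ((measurePreserving_permute_sampleLaw P σ).integrable_comp_of_integrable
      ((hA' P).sub (hB' P)))
  refine ae_eq_zero_of_permute_invariant P₁ (fun τ ω => ?_)
    (fun P => integrable_finsetSum _ fun σ _ => hint P σ) fun P => ?_
  · simp only [permute_permute]
    exact Equiv.sum_comp (Equiv.mulLeft τ) fun σ =>
      A.indicator (1 : (Fin n → 𝒴) × 𝒴 → ℝ) (permute σ ω) - B.indicator 1 (permute σ ω)
  · rw [integral_finsetSum _ fun σ _ => hint P σ]
    refine Finset.sum_eq_zero fun σ _ => ?_
    rw [(measurePreserving_permute_sampleLaw P σ).integral_comp'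
      (fun ω => A.indicator (1 : (Fin n → 𝒴) × 𝒴 → ℝ) ω - B.indicator 1 ω), integral_sub (hA' P) (hB' P),
      integral_indicator_one hA, integral_indicator_one hB, measureReal_def, measureReal_def, h,
      sub_self]

variable [TopologicalSpace 𝒴] [BorelSpace 𝒴] [HasOuterApproxClosed 𝒴]

/-- The predictive law is a mixture of exchangeable laws and μ^{n+1} is invariant, so uniqueness of
densities applies. The given version need not be symmetric everywhere. -/
theorem ae_density_permute_eq {π : Measure (DominatedLaw μ)} {p : (Fin n → 𝒴) × 𝒴 → ℝ}
    (hp : IsDensity p (samplePredictive n π) ((Measure.pi fun _ : Fin n => μ).prod μ))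
    (σ : Equiv.Perm (Fin (n + 1))) :
    ∀ᵐ ω ∂((Measure.pi fun _ : Fin n => μ).prod μ), p (permute σ ω) = p ω := by
  obtain ⟨hm, hnn, hd⟩ := hp
  have hm' : Measurable fun ω => ENNReal.ofReal (p ω) := hm.ennreal_ofReal
  have h : ((Measure.pi fun _ : Fin n => μ).prod μ).withDensity
        (fun ω => ENNReal.ofReal (p (permute σ ω))) =
      ((Measure.pi fun _ : Fin n => μ).prod μ).withDensity fun ω => ENNReal.ofReal (p ω) := by
    apply (permute σ).map_measurableEquiv_injective
    rw [map_withDensity_comp _ (permute σ).measurable hm', (measurePreserving_permute μ σ).map_eq,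
      ← hd, map_permute_samplePredictive]
  have hm'' : Measurable fun ω => ENNReal.ofReal (p (permute σ ω)) :=
    hm'.comp (permute σ).measurable
  filter_upwards [(withDensity_eq_iff_of_sigmaFinite hm''.aemeasurable hm'.aemeasurable).1 h] with ω hω
  exact (ENNReal.ofReal_eq_ofReal_iff (hnn _) (hnn _)).1 hω

theorem riskMeasure_predictiveRegion_optimal (π : Measure (DominatedLaw μ))
    [IsProbabilityMeasure π]
    (hac : Measure.pi (fun _ : Fin n => μ) ≪ xPredictive n π)
    {pX : (Fin n → 𝒴) → ℝ} {pXY : (Fin n → 𝒴) × 𝒴 → ℝ} {k : WeakLaw 𝒴 → ℝ}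
    (hX : IsDensity pX (xPredictive n π) (Measure.pi fun _ : Fin n => μ))
    (hXY : IsDensity pXY (samplePredictive n π) ((Measure.pi fun _ : Fin n => μ).prod μ))
    (hB : MeasurableSet (predictiveRegion n pX pXY k))
    {A : Set ((Fin n → 𝒴) × 𝒴)} (hA : MeasurableSet A)
    (hAB : ∀ P : DominatedLaw μ,
      sampleLaw n P A = sampleLaw n P (predictiveRegion n pX pXY k)) :
    riskMeasure n π (predictiveRegion n pX pXY k) ≤ riskMeasure n π A ∧
      (riskMeasure n π A = riskMeasure n π (predictiveRegion n pX pXY k) →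
        riskMeasure n π (predictiveRegion n pX pXY k) = ∞ ∨
          ∀ P : DominatedLaw μ,
            sampleLaw n P (symmDiff A (predictiveRegion n pX pXY k)) = 0) := by
  classical
  obtain ⟨P₁⟩ := nonempty_of_isProbabilityMeasure π
  set B := predictiveRegion n pX pXY k with hBdef
  set M := (Measure.pi fun _ : Fin n => μ).prod μ with hM
  obtain ⟨hXm, hXnn, hXd⟩ := hX
  have hX' : Measurable fun x => ENNReal.ofReal (pX x) := hXm.ennreal_ofReal
  -- Domination of μⁿ by the predictive law keeps the denominator of the posterior predictive
  -- density positive almost everywhere.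
  have hpos : ∀ᵐ ω ∂M, 0 < pX ω.1 := by
    have h1 : ∀ᵐ x ∂(Measure.pi fun _ : Fin n => μ), 0 < pX x := by
      refine hac.ae_le ?_
      rw [hXd]
      exact (ae_withDensity_iff hX').2 (ae_of_all _ fun x hx => by simpa using hx)
    exact Measure.quasiMeasurePreserving_fst.ae h1
  have hperm : ∀ {p : (Fin n → 𝒴) × 𝒴 → Prop}, (∀ᵐ ω ∂M, p ω) →
      ∀ᵐ ω ∂M, ∀ σ : Equiv.Perm (Fin (n + 1)), p (permute σ ω) := fun h =>
    ae_all_iff.2 fun σ => (measurePreserving_permute μ σ).quasiMeasurePreserving.ae h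
  have hrisk : riskMeasure n π = M.withDensity fun ω => ENNReal.ofReal (pX ω.1) := by
    rw [riskMeasure, hXd, prod_withDensity_left hX']
  -- The orbit sum of the risk density over C; its integral is (n + 1)! times the risk of C.
  let w : Set ((Fin n → 𝒴) × 𝒴) → (Fin n → 𝒴) × 𝒴 → ℝ := fun C ω =>
    ∑ σ, if permute σ ω ∈ C then pX (permute σ ω).1 else 0
  have hterm : ∀ {C : Set ((Fin n → 𝒴) × 𝒴)}, MeasurableSet C →
      Measurable fun ω => if ω ∈ C then pX ω.1 else 0 := fun hC =>
    Measurable.ite hC (hXm.comp measurable_fst) measurable_const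
  have hwnn : ∀ C ω, 0 ≤ w C ω := fun C ω => Finset.sum_nonneg fun σ _ => by
    split_ifs
    · exact hXnn _
    · exact le_rfl
  have hwm : ∀ {C : Set ((Fin n → 𝒴) × 𝒴)}, MeasurableSet C → Measurable (w C) := fun hC =>
    Finset.measurable_sum _ fun σ _ => (hterm hC).comp (permute σ).measurable
  have hw : ∀ {C : Set ((Fin n → 𝒴) × 𝒴)}, MeasurableSet C →
      ∫⁻ ω, ENNReal.ofReal (w C ω) ∂M =
        (Fintype.card (Equiv.Perm (Fin (n + 1))) : ℝ≥0∞) * riskMeasure n π C := by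
    intro C hC
    have hR : riskMeasure n π C =
        ∫⁻ ω, ENNReal.ofReal (if ω ∈ C then pX ω.1 else 0) ∂M := by
      rw [hrisk, withDensity_apply _ hC, ← lintegral_indicator hC]
      refine lintegral_congr fun ω => ?_
      by_cases hω : ω ∈ C <;> simp [hω]
    have hsum : ∀ ω, ENNReal.ofReal (w C ω) =
        ∑ σ, ENNReal.ofReal (if permute σ ω ∈ C then pX (permute σ ω).1 else 0) := fun ω =>
      ENNReal.ofReal_sum_of_nonneg fun σ _ => by
        split_ifs
        · exact hXnn _
        · exact le_rfl
    simp only [hsum]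
    have hpm : ∀ σ : Equiv.Perm (Fin (n + 1)), Measurable fun ω =>
        ENNReal.ofReal (if permute σ ω ∈ C then pX (permute σ ω).1 else 0) := fun σ =>
      ((hterm hC).comp (permute σ).measurable).ennreal_ofReal
    rw [lintegral_finsetSum _ fun σ _ => hpm σ,
      Finset.sum_congr rfl fun σ _ => ((measurePreserving_permute μ σ).lintegral_comp
      (hterm hC).ennreal_ofReal).trans hR.symm, Finset.sum_const, Finset.card_univ, nsmul_eq_mul]
  have hpt : ∀ᵐ ω ∂M, w B ω ≤ w A ω ∧ (w B ω = w A ω → (ω ∈ A ↔ ω ∈ B)) := by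
    filter_upwards [ae_sum_indicator_permute_eq_zero P₁ hA hB hAB, hperm hpos,
      ae_all_iff.2 fun σ => ae_density_permute_eq hXY σ] with ω h1 h2 h3
    -- Along an orbit the numerator `pXY` and the threshold `k` are constant; only the denominator
    -- varies.
    have h := sum_ite_le_of_threshold (x := fun σ => pX (permute σ ω).1) h2 (hXY.2.1 ω)
      (k := k (empirical n ω)) (a := fun σ => permute σ ω ∈ A) (b := fun σ => permute σ ω ∈ B)
      (fun σ => by rw [← h3 σ, ← empirical_permute σ ω]; rfl)
      (by simpa only [Set.indicator_apply, Pi.one_apply] using h1)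
    refine ⟨h.1, fun he => ?_⟩
    have := h.2 he 1
    rwa [permute_one] at this
  have hle : (fun ω => ENNReal.ofReal (w B ω)) ≤ᵐ[M] fun ω => ENNReal.ofReal (w A ω) := by
    filter_upwards [hpt] with ω hω using ENNReal.ofReal_le_ofReal hω.1
  have hcard0 : (Fintype.card (Equiv.Perm (Fin (n + 1))) : ℝ≥0∞) ≠ 0 := by
    exact_mod_cast Fintype.card_ne_zero
  have hcardtop : (Fintype.card (Equiv.Perm (Fin (n + 1))) : ℝ≥0∞) ≠ ∞ :=
    ENNReal.natCast_ne_top _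
  refine ⟨?_, fun heq => or_iff_not_imp_left.2 fun hfin P => ?_⟩
  · have := lintegral_mono_ae hle
    rwa [hw hA, hw hB, ENNReal.mul_le_mul_iff_right hcard0 hcardtop] at this
  -- Finite risk is what lets equal integrals of ordered functions force equality almost everywhere.
  · have hae := ae_eq_of_ae_le_of_lintegral_le hle
      (by rw [hw hB]; exact ENNReal.mul_ne_top hcardtop hfin) (hwm hA).ennreal_ofReal.aemeasurable
      (by rw [hw hA, hw hB, heq])
    refine sampleLaw_absolutelyContinuous P (measure_eq_zero_iff_ae_notMem.2 ?_)
    filter_upwards [hae, hpt] with ω h1 h2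
    have := h2.2 ((ENNReal.ofReal_eq_ofReal_iff (hwnn _ _) (hwnn _ _)).1 h1)
    rw [Set.mem_symmDiff]
    tauto

end Optimality

end

theorem theorem6 {𝒴 : Type*} [MetricSpace 𝒴] [CompleteSpace 𝒴] [TopologicalSpace.SeparableSpace 𝒴]
    [LocallyCompactSpace 𝒴] [MeasurableSpace 𝒴] [BorelSpace 𝒴]
    (μ : Measure 𝒴) [SigmaFinite μ] [μ.Regular] (n : ℕ)
    (π : Measure (DominatedLaw μ)) [IsProbabilityMeasure π] :
    -- the risk measure is σ-finite and Radon
    (SigmaFinite (riskMeasure n π) ∧ (riskMeasure n π).Regular) ∧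
    -- its image under the empirical distribution is σ-finite
    (Measurable (empirical n : (Fin n → 𝒴) × 𝒴 → WeakLaw 𝒴) ∧
      SigmaFinite ((riskMeasure n π).map (empirical n))) ∧
    -- it has a disintegration along the empirical distribution
    HasDisintegration (riskMeasure n π) (empirical n) ∧
    -- sufficiency, completeness and optimality under the two additional assumptions
    ((NullSingletonClass μ ∨ (DiscreteTopology 𝒴 ∧ μ = Measure.count)) →
      xPredictive n π ≪ Measure.pi (fun _ : Fin n => μ) →
      Measure.pi (fun _ : Fin n => μ) ≪ xPredictive n π →
      IsRegularSufficient (sampleLaw n : DominatedLaw μ → Measure ((Fin n → 𝒴) × 𝒴))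
          (empirical n) ∧
        IsCompleteStatistic (sampleLaw n : DominatedLaw μ → Measure ((Fin n → 𝒴) × 𝒴))
          (empirical n) ∧
        ∀ (pX : (Fin n → 𝒴) → ℝ) (pXY : (Fin n → 𝒴) × 𝒴 → ℝ) (k : WeakLaw 𝒴 → ℝ),
          IsDensity pX (xPredictive n π) (Measure.pi fun _ : Fin n => μ) →
          IsDensity pXY (samplePredictive n π) ((Measure.pi fun _ : Fin n => μ).prod μ) →
          MeasurableSet (predictiveRegion n pX pXY k) →
          ∀ A : Set ((Fin n → 𝒴) × 𝒴), MeasurableSet A →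
            (∀ P : DominatedLaw μ,
              sampleLaw n P A = sampleLaw n P (predictiveRegion n pX pXY k)) →
            riskMeasure n π (predictiveRegion n pX pXY k) ≤ riskMeasure n π A ∧
            (riskMeasure n π A = riskMeasure n π (predictiveRegion n pX pXY k) →
              riskMeasure n π (predictiveRegion n pX pXY k) = ∞ ∨
                ∀ P : DominatedLaw μ,
                  sampleLaw n P (symmDiff A (predictiveRegion n pX pXY k)) = 0)) := by
  have hZ : Measurable (empirical n : (Fin n → 𝒴) × 𝒴 → WeakLaw 𝒴) :=
    continuous_empirical.measurable
  obtain ⟨P₁⟩ := nonempty_of_isProbabilityMeasure π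
  have : Nonempty 𝒴 := nonempty_of_isProbabilityMeasure P₁.toMeasure
  have hσ : SigmaFinite ((riskMeasure n π).map (empirical n)) :=
    sigmaFinite_map_empirical hZ (xPredictive n π) μ
  refine ⟨⟨?_, ?_⟩, ⟨hZ, hσ⟩, hasDisintegration_of_sigmaFinite_map _ hZ, fun _ _ hac =>
    ⟨isRegularSufficient_empirical hZ P₁, isCompleteStatistic_empirical hZ,
      fun pX pXY k hX hXY hB A hA hAB =>
        riskMeasure_predictiveRegion_optimal π hac hX hXY hB hA hAB⟩⟩
  · unfold riskMeasure
    infer_instance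
  · unfold riskMeasure
    have := UniformSpace.secondCountable_of_separable 𝒴
    -- On this locally compact, second countable space, finiteness on compact sets gives local
    -- finiteness, and σ-compactness then gives regularity.
    have hloc : IsLocallyFiniteMeasure ((xPredictive n π).prod μ) :=
      isLocallyFiniteMeasure_of_isFiniteMeasureOnCompacts
    exact Measure.Regular.of_sigmaCompactSpace_of_isLocallyFiniteMeasure _
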